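/- For an integer $K\ge 1$ and a Euclidean space $\mathbb R^n$, let $GMM_n(K)$ be the set of probability measures on $\mathbb R^n$ of the form $\sum_{k=1}^{K}\pi_k\,\mathcal N(m_k,\Sigma_k)$, where $\pi_k\ge 0$, $\sum_{k=1}^K\pi_k=1$, $m_k\in\mathbb R^n$ and $\Sigma_k$ is a symmetric positive semidefinite matrix (degenerate Gaussians and zero weights are allowed, so these are the Gaussian mixtures with at most $K$ components), and let $GMM_n(\infty)=\bigcup_{K\ge1}GMM_n(K)$. For probability measures $\mu_0,\mu_1$ on $\mathbb R^d$, let $\Pi(\mu_0,\mu_1)$ be the set of probability measures on $\mathbb R^d\times\mathbb R^d=\mathbb R^{2d}$ with first marginal $\mu_0$ and second marginal $\mu_1$. Let $d,K_0,K_1\ge 1$, $\mu_0\in GMM_d(K_0)$ and $\mu_1\in GMM_d(K_1)$. Then the infimum $$MW_2^2(\mu_0,\mu_1)=\inf_{\gamma\in\Pi(\mu_0,\mu_1)\cap GMM_{2d}(\infty)}\int_{\mathbb R^d\times\mathbb R^d}\|y_0-y_1\|^2\,d\gamma(y_0,y_1)$$ is attained by some $\gamma^*\in\Pi(\mu_0,\mu_1)\cap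 GMM_{2d}(K_0+K_1-1)$. -/

import Mathlib

open MeasureTheory ProbabilityTheory
open scoped NNReal ENNReal

noncomputable section

/-- `GMM E K`: the probability measures on `E` that are finite Gaussian mixtures with at most `K`
components, i.e. `∑ k, π k • ν k` with `π` in the simplex (zero weights allowed) and every `ν k`
a Gaussian measure, possibly degenerate. Gaussianity depends only on the topology and the linear
structure of `E`, so `E` may be the product `ℝ^d × ℝ^d`, identified with `ℝ^(2d)`. -/
def GMM (E : Type*) [TopologicalSpace E] [AddCommMonoid E] [Module ℝ E] [MeasurableSpace E]
    (K : ℕ) : Set (Measure E) :=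
  {μ | ∃ (π : Fin K → ℝ≥0) (ν : Fin K → Measure E),
    ∑ k, π k = 1 ∧ (∀ k, IsGaussian (ν k)) ∧ μ = ∑ k, π k • ν k}

/-- The set of all finite Gaussian mixtures on `E`. -/
def GMMInf (E : Type*) [TopologicalSpace E] [AddCommMonoid E] [Module ℝ E] [MeasurableSpace E] :
    Set (Measure E) :=
  ⋃ K : ℕ, GMM E K

/-- The transport plans between `μ₀` and `μ₁`: probability measures on `E × E` with marginals
`μ₀` and `μ₁`. -/
def transportPlans {E : Type*} [MeasurableSpace E] (μ₀ μ₁ : Measure E) : Set (Measure (E × E)) :=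
  {γ | IsProbabilityMeasure γ ∧ γ.map Prod.fst = μ₀ ∧ γ.map Prod.snd = μ₁}

/-- The quadratic transport cost `∫ ‖y₀ - y₁‖² dγ(y₀, y₁)`, for the Euclidean norm on `ℝ^d`. -/
def quadCost {d : ℕ}
    (γ : Measure (EuclideanSpace ℝ (Fin d) × EuclideanSpace ℝ (Fin d))) : ℝ≥0∞ :=
  ∫⁻ y, ENNReal.ofReal (‖y.1 - y.2‖ ^ 2) ∂γ

/-- The squared mixture Wasserstein distance `MW₂²(μ₀, μ₁)`: the infimum of the quadratic cost over
the transport plans that are finite Gaussian mixtures. -/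
def MW2Sq {d : ℕ} (μ₀ μ₁ : Measure (EuclideanSpace ℝ (Fin d))) : ℝ≥0∞ :=
  ⨅ γ ∈ transportPlans μ₀ μ₁ ∩ GMMInf (EuclideanSpace ℝ (Fin d) × EuclideanSpace ℝ (Fin d)),
    quadCost γ

end

/-!
Gaussian mixtures are identifiable: distinct Gaussian measures are linearly independent, because
some linear functional `L` separates the (variance, mean) pairs of finitely many of them and the
exponentials `exp (m t + v t² / 2)` of distinct pairs are linearly independent. Hence the marginals
of the components of a Gaussian mixture plan recombine exactly into the components of `μ₀` and
`μ₁`: the weights of the plan form a discrete coupling of the weights of `μ₀` and `μ₁`.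

Between two Gaussian measures there is a cheapest Gaussian plan, since Gaussian plans are images of
a fixed standard Gaussian vector under affine maps whose linear parts range over a compact set, on
which the cost is lower semicontinuous. Replacing each component of a mixture plan by a cheapest
plan between its marginals reduces the problem to a linear program over discrete couplings. There,
moving along linear relations between the marginal constraints (conic Carathéodory) leads to an
optimal coupling supported on linearly independent constraints. The `K₀ + K₁` marginal constraints
satisfy one relation, equality of the total masses, so at most `K₀ + K₁ - 1` atoms remain.
-/

section ConicCaratheodory

variable {ι V : Type*} [AddCommGroup V] [Module ℝ V]

/-- Move from `w` in the direction `h` until the first coordinate vanishes. -/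
lemma exists_add_smul_nonneg_support_ssubset {w h : ι →₀ ℝ} (hw : 0 ≤ w)
    (hsupp : h.support ⊆ w.support) {i : ι} (hi : h i < 0) :
    ∃ t : ℝ, 0 ≤ t ∧ 0 ≤ w + t • h ∧ (w + t • h).support ⊂ w.support := by
  classical
  obtain ⟨k, hk, hmin⟩ := (h.support.filter (h · < 0)).exists_min_image (fun j ↦ w j / -h j)
    ⟨i, by simp [hi, hi.ne]⟩
  have hk_neg : h k < 0 := (Finset.mem_filter.1 hk).2
  have hwk : w k ≠ 0 := Finsupp.mem_support_iff.1 (hsupp (Finset.mem_filter.1 hk).1)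
  refine ⟨w k / -h k, div_nonneg (hw k) (by linarith), fun j ↦ ?_, ?_⟩
  · simp only [Finsupp.coe_zero, Pi.zero_apply, Finsupp.add_apply, Finsupp.smul_apply, smul_eq_mul]
    rcases le_or_gt 0 (h j) with hj | hj
    · exact add_nonneg (hw j) (mul_nonneg (div_nonneg (hw k) (by linarith)) hj)
    · have := hmin j (by simp [hj, hj.ne])
      rw [le_div_iff₀ (by linarith)] at this
      linarith
  · refine (Finset.ssubset_iff_of_subset ?_).2
      ⟨k, Finsupp.mem_support_iff.2 hwk, Finsupp.notMem_support_iff.2 ?_⟩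
    · exact Finsupp.support_add.trans
        (Finset.union_subset subset_rfl (Finsupp.support_smul.trans hsupp))
    · simp only [Finsupp.add_apply, Finsupp.smul_apply, smul_eq_mul]
      field_simp [hk_neg.ne]
      ring

/-- A direction with nonnegative coordinates and nonpositive cost has zero cost, so it may be
reversed. -/
lemma exists_descent_direction {v : ι → V} {c : ι → ℝ} (hc : 0 ≤ c) {s : Set ι}
    (hdep : ¬ LinearIndepOn ℝ v s) :
    ∃ h ∈ Finsupp.supported ℝ ℝ s, Finsupp.linearCombination ℝ v h = 0 ∧
      Finsupp.linearCombination ℝ c h ≤ 0 ∧ ∃ i, h i < 0 := by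
  obtain ⟨h, hsupp, hker, hne, hcost⟩ : ∃ h ∈ Finsupp.supported ℝ ℝ s,
      Finsupp.linearCombination ℝ v h = 0 ∧ h ≠ 0 ∧ Finsupp.linearCombination ℝ c h ≤ 0 := by
    obtain ⟨h, hsupp, hker, hne⟩ := linearDepOn_iff'.1 hdep
    rcases le_total (Finsupp.linearCombination ℝ c h) 0 with hle | hge
    · exact ⟨h, hsupp, hker, hne, hle⟩
    · exact ⟨-h, neg_mem hsupp, by simp [hker], neg_ne_zero.2 hne, by simpa using hge⟩
  by_cases hneg : ∃ i, h i < 0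
  · exact ⟨h, hsupp, hker, hcost, hneg⟩
  push Not at hneg
  have hcost_nonneg : 0 ≤ Finsupp.linearCombination ℝ c h := by
    rw [Finsupp.linearCombination_apply]
    exact Finset.sum_nonneg fun i _ ↦ mul_nonneg (hneg i) (hc i)
  obtain ⟨i, hi⟩ := Finsupp.ne_iff.1 hne
  exact ⟨-h, neg_mem hsupp, by simp [hker], by simpa using hcost_nonneg, i,
    neg_lt_zero.2 ((hneg i).lt_of_ne' hi)⟩

/-- Conic Carathéodory theorem, with a cost to be kept under control. -/
theorem exists_linearIndepOn_support_linearCombination_le (v : ι → V) {c : ι → ℝ} (hc : 0 ≤ c)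
    {w : ι →₀ ℝ} (hw : 0 ≤ w) :
    ∃ w' : ι →₀ ℝ, 0 ≤ w' ∧ w'.support ⊆ w.support ∧ LinearIndepOn ℝ v (w'.support : Set ι) ∧
      Finsupp.linearCombination ℝ v w' = Finsupp.linearCombination ℝ v w ∧
      Finsupp.linearCombination ℝ c w' ≤ Finsupp.linearCombination ℝ c w := by
  induction hs : w.support using Finset.strongInduction generalizing w with
  | H s ih =>
    subst hs
    by_cases hindep : LinearIndepOn ℝ v (w.support : Set ι)
    · exact ⟨w, hw, subset_rfl, hindep, rfl, le_rfl⟩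
    obtain ⟨h, hsupp, hker, hcost, i, hi⟩ := exists_descent_direction hc hindep
    obtain ⟨t, ht, hnonneg, hlt⟩ := exists_add_smul_nonneg_support_ssubset hw
      (Finset.coe_subset.1 hsupp) hi
    obtain ⟨w', hw', hsub, hindep', hcomb, hle⟩ := ih _ hlt hnonneg rfl
    refine ⟨w', hw', hsub.trans hlt.subset, hindep', ?_, hle.trans ?_⟩
    · rw [hcomb, map_add, map_smul, hker, smul_zero, add_zero]
    · rw [map_add, map_smul, smul_eq_mul]
      linarith [mul_nonpos_of_nonneg_of_nonpos ht hcost]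

/-- The inclusion of `ℝ≥0`-valued into real-valued finitely supported weights: over `ℝ`,
weights can be moved along signed linear relations. -/
noncomputable def realWeights : (ι →₀ ℝ≥0) →ₗ[ℝ≥0] (ι →₀ ℝ) :=
  Finsupp.mapRange.linearMap (Algebra.linearMap ℝ≥0 ℝ)

lemma realWeights_apply (w : ι →₀ ℝ≥0) (i : ι) : realWeights w i = w i := rfl

lemma realWeights_injective : Function.Injective (realWeights (ι := ι)) :=
  Finsupp.mapRange_injective _ (map_zero _) NNReal.coe_injective

lemma support_realWeights (w : ι →₀ ℝ≥0) : (realWeights w).support = w.support := by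
  ext i
  simp [realWeights_apply]

lemma exists_realWeights_eq {w : ι →₀ ℝ} (hw : 0 ≤ w) : ∃ u : ι →₀ ℝ≥0, realWeights u = w := by
  refine ⟨w.mapRange Real.toNNReal Real.toNNReal_zero, Finsupp.ext fun i ↦ ?_⟩
  rw [realWeights_apply, Finsupp.mapRange_apply, Real.coe_toNNReal _ (hw i)]

lemma linearCombination_realWeights (v : ι → V) (w : ι →₀ ℝ≥0) :
    Finsupp.linearCombination ℝ v (realWeights w) = Finsupp.linearCombination ℝ≥0 v w := by
  simp only [Finsupp.linearCombination_apply, Finsupp.sum, support_realWeights,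
    realWeights_apply, NNReal.smul_def]

lemma linearCombination_ne_top_iff {C : ι → ℝ≥0∞} {w : ι →₀ ℝ≥0} :
    Finsupp.linearCombination ℝ≥0 C w ≠ ∞ ↔ ∀ i ∈ w.support, C i ≠ ∞ := by
  rw [Finsupp.linearCombination_apply, Finsupp.sum, ENNReal.sum_ne_top]
  exact forall₂_congr fun i hi ↦
    ENNReal.nnreal_smul_ne_top_iff (Finsupp.mem_support_iff.1 hi)

lemma toReal_linearCombination (C : ι → ℝ≥0∞) {w : ι →₀ ℝ≥0} (hC : ∀ i ∈ w.support, C i ≠ ∞) :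
    (Finsupp.linearCombination ℝ≥0 C w).toReal =
      Finsupp.linearCombination ℝ (fun i ↦ (C i).toReal) (realWeights w) := by
  rw [linearCombination_realWeights, Finsupp.linearCombination_apply,
    Finsupp.linearCombination_apply, Finsupp.sum, ENNReal.toReal_sum]
  · exact Finset.sum_congr rfl fun i _ ↦ ENNReal.toReal_smul _ _
  · exact fun i hi ↦ ENNReal.nnreal_smul_ne_top (hC i hi)

theorem exists_linearIndepOn_support_linearCombination_le_ennreal (v : ι → V) (C : ι → ℝ≥0∞)
    (w : ι →₀ ℝ≥0) :
    ∃ w' : ι →₀ ℝ≥0, LinearIndepOn ℝ v (w'.support : Set ι) ∧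
      Finsupp.linearCombination ℝ≥0 v w' = Finsupp.linearCombination ℝ≥0 v w ∧
      Finsupp.linearCombination ℝ≥0 C w' ≤ Finsupp.linearCombination ℝ≥0 C w := by
  obtain ⟨u, hu, hsub, hindep, hcomb, hle⟩ := exists_linearIndepOn_support_linearCombination_le v
    (c := fun i ↦ (C i).toReal) (fun _ ↦ ENNReal.toReal_nonneg) (w := realWeights w)
    fun i ↦ (w i).coe_nonneg
  obtain ⟨w', rfl⟩ := exists_realWeights_eq hu
  simp only [support_realWeights] at hsub hindep
  refine ⟨w', hindep, by simpa only [linearCombination_realWeights] using hcomb, ?_⟩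
  by_cases htop : Finsupp.linearCombination ℝ≥0 C w = ∞
  · simp [htop]
  have hC := linearCombination_ne_top_iff.1 htop
  have hC' : ∀ i ∈ w'.support, C i ≠ ∞ := fun i hi ↦ hC i (hsub hi)
  rw [← ENNReal.toReal_le_toReal (linearCombination_ne_top_iff.2 hC') htop]
  rwa [toReal_linearCombination C hC, toReal_linearCombination C hC']

end ConicCaratheodory

section WeightCouplings

variable {α β : Type*}

/-- The discrete transport polytope: finitely supported weights on `α × β` with
marginals `a` and `b`. -/
def weightCouplings (a : α →₀ ℝ≥0) (b : β →₀ ℝ≥0) : Set (α × β →₀ ℝ≥0) :=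
  {W | W.mapDomain Prod.fst = a ∧ W.mapDomain Prod.snd = b}

/-- The column at `p` of the marginal constraints of the transport problem. -/
noncomputable def marginalVector (p : α × β) : (α →₀ ℝ) × (β →₀ ℝ) :=
  (Finsupp.single p.1 1, Finsupp.single p.2 1)

lemma linearCombination_marginalVector (W : α × β →₀ ℝ≥0) :
    Finsupp.linearCombination ℝ≥0 marginalVector W =
      (realWeights (W.mapDomain Prod.fst), realWeights (W.mapDomain Prod.snd)) := by
  induction W using Finsupp.induction_linear with
  | zero => simp only [map_zero, Finsupp.mapDomain_zero, Prod.mk_zero_zero]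
  | add W W' hW hW' => simp only [map_add, hW, hW', Finsupp.mapDomain_add, Prod.mk_add_mk]
  | single p c =>
    simp [marginalVector, realWeights, NNReal.smul_def, Finsupp.mapDomain_single]

lemma mem_weightCouplings_iff_of_linearCombination_eq {W W' : α × β →₀ ℝ≥0}
    (h : Finsupp.linearCombination ℝ≥0 marginalVector W =
      Finsupp.linearCombination ℝ≥0 marginalVector W') {a : α →₀ ℝ≥0} {b : β →₀ ℝ≥0} :
    W ∈ weightCouplings a b ↔ W' ∈ weightCouplings a b := by
  rw [linearCombination_marginalVector, linearCombination_marginalVector, Prod.mk.injEq,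
    realWeights_injective.eq_iff, realWeights_injective.eq_iff] at h
  rw [weightCouplings, Set.mem_ofPred_eq, Set.mem_ofPred_eq, h.1, h.2]

lemma linearCombination_marginalVector_of_mem {a : α →₀ ℝ≥0} {b : β →₀ ℝ≥0}
    {W : α × β →₀ ℝ≥0} (hW : W ∈ weightCouplings a b) :
    Finsupp.linearCombination ℝ≥0 marginalVector W = (realWeights a, realWeights b) := by
  rw [linearCombination_marginalVector, hW.1, hW.2]

lemma apply_mem_support_mapDomain {M : Type*} [AddCommMonoid M] [PartialOrder M]
    [CanonicallyOrderedAdd M] (f : α → β) {w : α →₀ M} {i : α} (hi : i ∈ w.support) :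
    f i ∈ (w.mapDomain f).support := by
  rw [Finsupp.mem_support_iff] at hi ⊢
  have hle : w i ≤ w.mapDomain f (f i) := by
    rw [← Finsupp.single_add_erase i w, Finsupp.mapDomain_add, Finsupp.mapDomain_single]
    simp
  exact ((pos_iff_ne_zero.2 hi).trans_le hle).ne'

lemma support_subset_of_mem_weightCouplings {a : α →₀ ℝ≥0} {b : β →₀ ℝ≥0}
    {W : α × β →₀ ℝ≥0} (hW : W ∈ weightCouplings a b) : W.support ⊆ a.support ×ˢ b.support := by
  intro p hp
  rw [Finset.mem_product, ← hW.1, ← hW.2]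
  exact ⟨apply_mem_support_mapDomain _ hp, apply_mem_support_mapDomain _ hp⟩

lemma mapDomain_const_eq_single_degree {M : Type*} [AddCommMonoid M] (a : α →₀ M) (j : β) :
    a.mapDomain (fun _ ↦ j) = Finsupp.single j a.degree := by
  rw [Finsupp.mapDomain, Finsupp.sum, ← Finsupp.single_finsetSum, Finsupp.degree_apply]

lemma weightCouplings_nonempty {a : α →₀ ℝ≥0} {b : β →₀ ℝ≥0} (ha : a.degree = 1)
    (hb : b.degree = 1) : (weightCouplings a b).Nonempty := by
  have hfst (i : α) : (b.mapDomain (Prod.mk i)).mapDomain Prod.fst = Finsupp.single i 1 := by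
    rw [← Finsupp.mapDomain_comp, ← hb]
    exact mapDomain_const_eq_single_degree b i
  have hsnd (i : α) : (b.mapDomain (Prod.mk i)).mapDomain Prod.snd = b := by
    rw [← Finsupp.mapDomain_comp]
    exact Finsupp.mapDomain_id
  refine ⟨a.sum fun i c ↦ c • b.mapDomain (Prod.mk i), ?_, ?_⟩
  · simp only [Finsupp.sum, Finsupp.mapDomain_finsetSum, Finsupp.mapDomain_smul, hfst,
      Finsupp.smul_single_one]
    exact a.sum_single
  · simp only [Finsupp.sum, Finsupp.mapDomain_finsetSum, Finsupp.mapDomain_smul, hsnd]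
    rw [← Finset.sum_smul, ← Finsupp.degree_apply, ha, one_smul]

/-- The marginal columns lie in the hyperplane where the two total masses agree, which does not
contain the unit vectors `(eᵢ, 0)`. -/
lemma card_lt_of_linearIndepOn_marginalVector {S : Finset (α × β)} {s : Finset α} {t : Finset β}
    (hS : S ⊆ s ×ˢ t) (hs : s.Nonempty)
    (hindep : LinearIndepOn ℝ marginalVector (S : Set (α × β))) : S.card < s.card + t.card := by
  classical
  let unitVector : α ⊕ β → (α →₀ ℝ) × (β →₀ ℝ) :=
    Sum.elim (fun i ↦ (Finsupp.single i 1, 0)) (fun j ↦ (0, Finsupp.single j 1))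
  let massDiff : (α →₀ ℝ) × (β →₀ ℝ) →ₗ[ℝ] ℝ :=
    (Finsupp.linearCombination ℝ 1).coprod (-Finsupp.linearCombination ℝ 1)
  let columns := S.image marginalVector
  let units := (s.disjSum t).image unitVector
  let U := Submodule.span ℝ (columns : Set ((α →₀ ℝ) × (β →₀ ℝ)))
  let F := Submodule.span ℝ (units : Set ((α →₀ ℝ) × (β →₀ ℝ)))
  have hunit (k) (hk : k ∈ s.disjSum t) : unitVector k ∈ F :=
    Submodule.subset_span (Finset.mem_image_of_mem _ hk)
  have hle : U ≤ F := by
    refine Submodule.span_le.2 (Finset.forall_mem_image.2 fun p hp ↦ ?_)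
    obtain ⟨h₁, h₂⟩ := Finset.mem_product.1 (hS hp)
    have hsum : marginalVector p = unitVector (.inl p.1) + unitVector (.inr p.2) := by
      simp [marginalVector, unitVector]
    rw [hsum]
    exact add_mem (hunit _ (Finset.inl_mem_disjSum.2 h₁)) (hunit _ (Finset.inr_mem_disjSum.2 h₂))
  have hker : U ≤ LinearMap.ker massDiff := by
    refine Submodule.span_le.2 (Finset.forall_mem_image.2 fun p _ ↦ ?_)
    simp [massDiff, marginalVector]
  have hlt : U < F := by
    obtain ⟨i, hi⟩ := hs
    refine SetLike.lt_iff_le_and_exists.2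
      ⟨hle, unitVector (.inl i), hunit _ (Finset.inl_mem_disjSum.2 hi), fun hmem ↦ ?_⟩
    simpa [massDiff, unitVector] using hker hmem
  have hcolumns : LinearIndepOn ℝ id (columns : Set ((α →₀ ℝ) × (β →₀ ℝ))) := by
    simpa only [columns, Finset.coe_image] using hindep.id_image
  calc S.card = columns.card := (Finset.card_image_of_injOn hindep.injOn).symm
    _ = Module.finrank ℝ U := (finrank_span_finset_eq_card hcolumns).symm
    _ < Module.finrank ℝ F := Submodule.finrank_lt_finrank_of_lt hlt
    _ ≤ units.card := finrank_span_finset_le_card _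
    _ ≤ s.card + t.card := Finset.card_image_le.trans (Finset.card_disjSum s t).le

lemma finite_setOf_linearIndepOn_weightCouplings (a : α →₀ ℝ≥0) (b : β →₀ ℝ≥0) :
    {W ∈ weightCouplings a b |
      LinearIndepOn ℝ marginalVector (W.support : Set (α × β))}.Finite := by
  refine Set.Finite.of_injOn (f := Finsupp.support) (t := (a.support ×ˢ b.support).powerset)
    (fun W hW ↦ ?_) (fun W hW W' hW' heq ↦ ?_) (Finset.finite_toSet _)
  · exact Finset.mem_powerset.2 (support_subset_of_mem_weightCouplings hW.1)
  · refine realWeights_injective (linearIndepOn_iffₛ.1 hW.2 _ ?_ _ ?_ ?_)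
    · simp [Finsupp.mem_supported, support_realWeights]
    · simp [Finsupp.mem_supported, support_realWeights, heq]
    · rw [linearCombination_realWeights, linearCombination_realWeights,
        linearCombination_marginalVector_of_mem hW.1, linearCombination_marginalVector_of_mem hW'.1]

theorem exists_sparse_optimal_weightCoupling {a : α →₀ ℝ≥0} {b : β →₀ ℝ≥0} (ha : a ≠ 0)
    (hne : (weightCouplings a b).Nonempty) (C : α × β → ℝ≥0∞) :
    ∃ W ∈ weightCouplings a b, W.support.card < a.support.card + b.support.card ∧
      ∀ W' ∈ weightCouplings a b,
        Finsupp.linearCombination ℝ≥0 C W ≤ Finsupp.linearCombination ℝ≥0 C W' := by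
  have hreduce (W') (hW' : W' ∈ weightCouplings a b) : ∃ W ∈ weightCouplings a b,
      LinearIndepOn ℝ marginalVector (W.support : Set (α × β)) ∧
      Finsupp.linearCombination ℝ≥0 C W ≤ Finsupp.linearCombination ℝ≥0 C W' := by
    obtain ⟨W, hindep, hcomb, hle⟩ :=
      exists_linearIndepOn_support_linearCombination_le_ennreal marginalVector C W'
    exact ⟨W, (mem_weightCouplings_iff_of_linearCombination_eq hcomb).2 hW', hindep, hle⟩
  obtain ⟨W₀, hW₀⟩ := hne
  obtain ⟨W₁, hW₁, hindep₁, -⟩ := hreduce W₀ hW₀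
  obtain ⟨W, ⟨hW, hindep⟩, hmin⟩ := Set.exists_min_image _ (Finsupp.linearCombination ℝ≥0 C)
    (finite_setOf_linearIndepOn_weightCouplings a b) ⟨W₁, hW₁, hindep₁⟩
  refine ⟨W, hW, card_lt_of_linearIndepOn_marginalVector (support_subset_of_mem_weightCouplings hW)
    (Finsupp.support_nonempty_iff.2 ha) hindep, fun W' hW' ↦ ?_⟩
  obtain ⟨W'', hW'', hindep'', hle⟩ := hreduce W' hW'
  exact (hmin W'' ⟨hW'', hindep''⟩).trans hle

end WeightCouplings

section ExpQuadratic

open Filter Topology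

/-- The exponential `t ↦ exp (m t + v t² / 2)` attached to the pair `p = (v, m)`: the moment
generating function of a real Gaussian of mean `m` and variance `v`. The variance comes first so
that the growth at infinity is monotone in `p` for the lexicographic order. -/
noncomputable def expQuadratic (p : ℝ × ℝ) (t : ℝ) : ℝ :=
  Real.exp (p.2 * t + p.1 * t ^ 2 / 2)

lemma tendsto_linear_add_quadratic_atBot {m v : ℝ} (h : v < 0 ∨ v = 0 ∧ m < 0) :
    Tendsto (fun t : ℝ ↦ m * t + v * t ^ 2 / 2) atTop atBot := by
  rcases h with hv | ⟨rfl, hm⟩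
  · have hfactor : Tendsto (fun t : ℝ ↦ m + v / 2 * t) atTop atBot :=
      tendsto_atBot_add_const_left _ _ (tendsto_id.const_mul_atTop_of_neg (by linarith))
    refine (hfactor.atBot_mul_atTop₀ tendsto_id).congr fun t ↦ ?_
    simp only [id]
    ring
  · simpa using tendsto_id.const_mul_atTop_of_neg hm

lemma tendsto_expQuadratic_div_of_toLex_lt {p q : ℝ × ℝ} (h : toLex p < toLex q) :
    Tendsto (fun t ↦ expQuadratic p t / expQuadratic q t) atTop (𝓝 0) := by
  rw [Prod.Lex.toLex_lt_toLex] at h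
  have hquad := tendsto_linear_add_quadratic_atBot (m := p.2 - q.2) (v := p.1 - q.1)
    (by simpa only [sub_neg, sub_eq_zero] using h)
  refine (Real.tendsto_exp_atBot.comp hquad).congr fun t ↦ ?_
  rw [expQuadratic, expQuadratic, ← Real.exp_sub, Function.comp_apply]
  ring_nf

/-- The largest pair for the lexicographic order dominates all the others at infinity, so dividing
by its exponential isolates its coefficient. -/
theorem linearIndependent_expQuadratic : LinearIndependent ℝ expQuadratic := by
  rw [linearIndependent_iff']
  intro s a
  induction s using Finset.induction_on_max_value (fun p : ℝ × ℝ ↦ toLex p) with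
  | empty => simp
  | insert q s hq hmax ih =>
    intro hsum
    have hsum_div (t : ℝ) :
        a q + ∑ p ∈ s, a p * (expQuadratic p t / expQuadratic q t) = 0 := by
      have hqt : expQuadratic q t ≠ 0 := (Real.exp_pos _).ne'
      have := congrArg (· / expQuadratic q t) (congrFun hsum t)
      simpa [Finset.sum_insert hq, Finset.sum_apply, add_div, Finset.sum_div, mul_div_assoc,
        hqt] using this
    have hlt (p) (hp : p ∈ s) : toLex p < toLex q :=
      (hmax p hp).lt_of_ne fun h ↦ hq (toLex_inj.1 h ▸ hp)
    have hlim : Tendsto (fun t ↦ a q + ∑ p ∈ s, a p * (expQuadratic p t / expQuadratic q t)) atTop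
        (𝓝 (a q + ∑ p ∈ s, a p * 0)) :=
      tendsto_const_nhds.add <| tendsto_finsetSum _ fun p hp ↦
        (tendsto_expQuadratic_div_of_toLex_lt (hlt p hp)).const_mul _
    have haq : a q = 0 := by
      simpa [hsum_div, tendsto_const_nhds_iff, eq_comm] using hlim
    rw [Finset.sum_insert hq, haq, zero_smul, zero_add] at hsum
    exact (Finset.forall_mem_insert ..).2 ⟨haq, ih hsum⟩

end ExpQuadratic

section Separation

variable {ι V W : Type*} [NormedAddCommGroup V] [NormedSpace ℝ V]
  [NormedAddCommGroup W] [NormedSpace ℝ W]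

lemma dense_ne_of_analyticOnNhd {f g : V → W} (hf : AnalyticOnNhd ℝ f Set.univ)
    (hg : AnalyticOnNhd ℝ g Set.univ) (hne : f ≠ g) : Dense {x | f x ≠ g x} := by
  rw [dense_iff_inter_open]
  rintro U hU ⟨x, hx⟩
  by_contra hempty
  refine hne (hf.eq_of_eventuallyEq hg (z₀ := x) ?_)
  filter_upwards [hU.mem_nhds hx] with y hy
  by_contra hy'
  exact hempty ⟨y, hy, hy'⟩

/-- By Baire's theorem, finitely many dense open sets have a common point. -/
lemma exists_injOn_apply_of_analyticOnNhd [CompleteSpace V] {f : ι → V → W} {s : Set ι}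
    (hs : s.Finite) (hf : ∀ i ∈ s, AnalyticOnNhd ℝ (f i) Set.univ) (hinj : s.InjOn f) :
    ∃ x, s.InjOn fun i ↦ f i x := by
  have hcont (i) (hi : i ∈ s) : Continuous (f i) :=
    continuousOn_univ.1 (hf i hi).continuousOn
  have hdense : Dense (⋂ p ∈ s.offDiag, {x | f p.1 x ≠ f p.2 x}) := by
    refine dense_biInter_of_isOpen (fun p hp ↦ ?_) hs.offDiag.countable fun p hp ↦ ?_
    · exact isOpen_ne_fun (hcont p.1 hp.1) (hcont p.2 hp.2.1)
    · exact dense_ne_of_analyticOnNhd (hf p.1 hp.1) (hf p.2 hp.2.1)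
        fun h ↦ hp.2.2 (hinj hp.1 hp.2.1 h)
  obtain ⟨x, hx⟩ := hdense.nonempty
  refine ⟨x, fun i hi j hj hij ↦ ?_⟩
  by_contra hne
  exact Set.mem_iInter₂.1 hx (i, j) ⟨hi, hj, hne⟩ hij

end Separation

section Identifiability

variable {E : Type*} [NormedAddCommGroup E] [NormedSpace ℝ E] [MeasurableSpace E] [BorelSpace E]

/-- The variance and the mean of the linear functional `L` under `μ`, in the order used by
`expQuadratic`. As functions of `L` they determine a Gaussian measure. -/
noncomputable def dualMoments (μ : Measure E) (L : StrongDual ℝ E) : ℝ × ℝ :=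
  (covarianceBilinDual μ L L, L (∫ x, x ∂μ))

lemma analyticOnNhd_dualMoments (μ : Measure E) : AnalyticOnNhd ℝ (dualMoments μ) Set.univ := by
  intro L _
  have hcov : AnalyticAt ℝ (fun L ↦ covarianceBilinDual μ L L) L :=
    AnalyticAt.fun_comp (f := fun L ↦ (L, L)) ((covarianceBilinDual μ).analyticAt_bilinear (L, L))
      (analyticAt_id.prod analyticAt_id)
  exact hcov.prod ((ContinuousLinearMap.apply ℝ ℝ (∫ x, x ∂μ)).analyticAt L)

variable [CompleteSpace E] [SecondCountableTopology E]

lemma injOn_dualMoments_isGaussian :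
    Set.InjOn dualMoments {μ : Measure E | IsGaussian μ} := by
  intro μ (hμ : IsGaussian μ) ν (hν : IsGaussian ν) h
  refine Measure.ext_of_charFunDual ?_
  ext L
  obtain ⟨hvar, hmean⟩ := Prod.ext_iff.1 (congrFun h L)
  simp only [dualMoments] at hvar hmean
  simp only [IsGaussian.charFunDual_eq', id, hvar, hmean]

lemma integral_exp_dual_of_isGaussian (μ : Measure E) [IsGaussian μ] (L : StrongDual ℝ E) (t : ℝ) :
    ∫ x, Real.exp (t * L x) ∂μ = expQuadratic (dualMoments μ L) t := by
  have hmgf := mgf_gaussianReal (IsGaussian.map_eq_gaussianReal (μ := μ) L) t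
  rw [mgf] at hmgf
  rw [hmgf, IsGaussian.integral_dual, Real.coe_toNNReal _ (variance_nonneg _ _), expQuadratic,
    dualMoments, covarianceBilinDual_self_eq_variance IsGaussian.memLp_two_id]

lemma integrable_exp_dual_of_isGaussian (μ : Measure E) [IsGaussian μ] (L : StrongDual ℝ E)
    (t : ℝ) : Integrable (fun x ↦ Real.exp (t * L x)) μ :=
  .of_integral_ne_zero <| by
    rw [integral_exp_dual_of_isGaussian]
    exact (Real.exp_pos _).ne'

lemma integral_exp_dual_linearCombination {w : Measure E →₀ ℝ≥0}
    (hw : ∀ ν ∈ w.support, IsGaussian ν) (L : StrongDual ℝ E) (t : ℝ) :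
    ∫ x, Real.exp (t * L x) ∂(Finsupp.linearCombination ℝ≥0 id w) =
      Finsupp.linearCombination ℝ≥0 (fun ν ↦ expQuadratic (dualMoments ν L)) w t := by
  rw [Finsupp.linearCombination_apply, Finsupp.linearCombination_apply, Finsupp.sum, Finsupp.sum,
    integral_finsetSum_measure, Finset.sum_apply]
  · refine Finset.sum_congr rfl fun ν hν ↦ ?_
    have := hw ν hν
    rw [id, integral_smul_nnreal_measure, integral_exp_dual_of_isGaussian, Pi.smul_apply]
  · intro ν hν
    have := hw ν hν
    exact (integrable_exp_dual_of_isGaussian ν L t).smul_measure_nnreal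

/-- Identifiability of Gaussian mixtures. A single functional `L` separates all the components, and
the moment generating functions of the projections by `L` are exponentials of distinct quadratic
polynomials. -/
theorem linearIndepOn_id_isGaussian :
    LinearIndepOn ℝ≥0 (id : Measure E → Measure E) {μ | IsGaussian μ} := by
  rw [linearIndepOn_iffₛ]
  intro w hw w' hw' heq
  obtain ⟨L, hL⟩ := exists_injOn_apply_of_analyticOnNhd
    (w.support.finite_toSet.union w'.support.finite_toSet)
    (fun μ _ ↦ analyticOnNhd_dualMoments μ)
    (injOn_dualMoments_isGaussian.mono (Set.union_subset hw hw'))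
  have hindep : LinearIndepOn ℝ≥0 (fun μ ↦ expQuadratic (dualMoments μ L))
      (w.support ∪ w'.support : Set (Measure E)) :=
    (linearIndependent_expQuadratic.comp _ hL.injective).restrict_scalars fun a b h ↦ by
      simpa only [NNReal.smul_def, smul_eq_mul, mul_one, NNReal.coe_inj] using h
  refine linearIndepOn_iffₛ.1 hindep w Set.subset_union_left w' Set.subset_union_right ?_
  ext t
  rw [← integral_exp_dual_linearCombination hw, ← integral_exp_dual_linearCombination hw', heq]

end Identifiability

section LowerSemicontinuity

open Filter Topology

lemma lowerSemicontinuous_lintegral {X Ω : Type*} [TopologicalSpace X] [FirstCountableTopology X]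
    [MeasurableSpace Ω] {μ : Measure Ω} {f : X → Ω → ℝ≥0∞} (hf : ∀ x, Measurable (f x))
    (hlsc : ∀ ω, LowerSemicontinuous fun x ↦ f x ω) :
    LowerSemicontinuous fun x ↦ ∫⁻ ω, f x ω ∂μ := by
  rw [lowerSemicontinuous_iff_le_liminf]
  intro x
  calc ∫⁻ ω, f x ω ∂μ ≤ ∫⁻ ω, liminf (fun y ↦ f y ω) (𝓝 x) ∂μ :=
        lintegral_mono fun ω ↦ (hlsc ω).le_liminf x
    _ ≤ liminf (fun y ↦ ∫⁻ ω, f y ω ∂μ) (𝓝 x) := lintegral_liminf_le hf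

end LowerSemicontinuity

section AffineGaussian

variable {V E F : Type*} [NormedAddCommGroup V] [InnerProductSpace ℝ V] [FiniteDimensional ℝ V]
  [MeasurableSpace V] [BorelSpace V]
  [NormedAddCommGroup E] [NormedSpace ℝ E] [MeasurableSpace E] [BorelSpace E]
  [NormedAddCommGroup F] [NormedSpace ℝ F] [MeasurableSpace F] [BorelSpace F]

/-- The law of `m + T Z`, where `Z` is a standard Gaussian vector in `V`. Encoding a Gaussian
measure by its mean and such a factor `T`, rather than by its covariance, lets measures vary with
the random source `Z` fixed. -/
noncomputable def affineGaussian (m : E) (T : V →L[ℝ] E) : Measure E :=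
  (stdGaussian V).map fun z ↦ m + T z

lemma map_affineGaussian (m : E) (T : V →L[ℝ] E) (L : E →L[ℝ] F) :
    (affineGaussian m T).map L = affineGaussian (L m) (L.comp T) := by
  rw [affineGaussian, Measure.map_map (by fun_prop) (by fun_prop)]
  simp only [affineGaussian, Function.comp_def, map_add, ContinuousLinearMap.comp_apply]

lemma lintegral_affineGaussian (m : E) (T : V →L[ℝ] E) {f : E → ℝ≥0∞} (hf : Measurable f) :
    ∫⁻ x, f x ∂affineGaussian m T = ∫⁻ z, f (m + T z) ∂stdGaussian V :=
  lintegral_map hf (by fun_prop)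

lemma lowerSemicontinuous_lintegral_affineGaussian {c : E → ℝ≥0∞} (hc : LowerSemicontinuous c)
    (m : E) : LowerSemicontinuous fun T : V →L[ℝ] E ↦ ∫⁻ x, c x ∂affineGaussian m T := by
  simp only [lintegral_affineGaussian _ _ hc.measurable]
  exact lowerSemicontinuous_lintegral (fun T ↦ hc.measurable.comp (by fun_prop))
    fun z ↦ hc.comp (by fun_prop)

variable [SecondCountableTopology E]

instance isGaussian_affineGaussian (m : E) (T : V →L[ℝ] E) : IsGaussian (affineGaussian m T) := by
  have hcomp : (fun z ↦ m + T z) = (fun x ↦ m + x) ∘ T := rfl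
  rw [affineGaussian, hcomp, ← Measure.map_map (measurable_const_add m) (by fun_prop)]
  infer_instance

variable [CompleteSpace E]

lemma integral_id_affineGaussian (m : E) (T : V →L[ℝ] E) : ∫ x, x ∂affineGaussian m T = m := by
  rw [affineGaussian, integral_map (by fun_prop) (by fun_prop), integral_add (integrable_const _)
    (T.integrable_comp IsGaussian.integrable_fun_id)]
  simp [T.integral_comp_comm IsGaussian.integrable_fun_id]

lemma dualMoments_affineGaussian (m : E) (T : V →L[ℝ] E) (L : StrongDual ℝ E) :
    dualMoments (affineGaussian m T) L = (‖L.comp T‖ ^ 2, L m) := by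
  have hL : (fun x ↦ L x) ∘ (fun z ↦ m + T z) = fun z ↦ L m + L.comp T z := by
    ext z
    simp
  rw [dualMoments, Prod.mk.injEq]
  constructor
  · rw [covarianceBilinDual_self_eq_variance IsGaussian.memLp_two_id, affineGaussian,
      variance_map (by fun_prop) (by fun_prop), hL, variance_const_add (by fun_prop),
      variance_dual_stdGaussian]
  · rw [integral_id_affineGaussian]

end AffineGaussian

section GaussianFactors

variable {V E : Type*} [NormedAddCommGroup V] [InnerProductSpace ℝ V] [FiniteDimensional ℝ V]
  [MeasurableSpace V] [BorelSpace V]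
  [NormedAddCommGroup E] [NormedSpace ℝ E] [MeasurableSpace E] [BorelSpace E]

variable (V) in
/-- The square roots `T : V → E` of the covariance of a Gaussian measure `μ`, in the sense that `μ`
is the law of `mean + T Z` for a standard Gaussian vector `Z` in `V`. -/
def gaussianFactors (μ : Measure E) : Set (V →L[ℝ] E) :=
  {T | affineGaussian (∫ x, x ∂μ) T = μ}

variable [CompleteSpace E] [SecondCountableTopology E]

lemma mem_gaussianFactors_affineGaussian (m : E) (T : V →L[ℝ] E) :
    T ∈ gaussianFactors V (affineGaussian m T) := by
  rw [gaussianFactors, Set.mem_ofPred_eq, integral_id_affineGaussian]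

lemma mem_gaussianFactors_iff {μ : Measure E} [IsGaussian μ] {T : V →L[ℝ] E} :
    T ∈ gaussianFactors V μ ↔
      ∀ L : StrongDual ℝ E, ‖L.comp T‖ ^ 2 = covarianceBilinDual μ L L := by
  have hdual : T ∈ gaussianFactors V μ ↔
      dualMoments (affineGaussian (∫ x, x ∂μ) T) = dualMoments μ :=
    (injOn_dualMoments_isGaussian.eq_iff (isGaussian_affineGaussian _ T) ‹IsGaussian μ›).symm
  rw [hdual, funext_iff]
  simp_rw [dualMoments_affineGaussian]
  simp only [dualMoments, Prod.mk.injEq, and_true]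

lemma isClosed_gaussianFactors (μ : Measure E) [IsGaussian μ] :
    IsClosed (gaussianFactors V μ) := by
  have hinter : gaussianFactors V μ =
      ⋂ L : StrongDual ℝ E, {T | ‖L.comp T‖ ^ 2 = covarianceBilinDual μ L L} := by
    ext T
    simp only [mem_gaussianFactors_iff, Set.mem_iInter, Set.mem_ofPred_eq]
  rw [hinter]
  exact isClosed_iInter fun L ↦ isClosed_eq (by fun_prop) continuous_const

lemma covarianceBilinDual_self_le_integral_norm_sq (μ : Measure E) [IsGaussian μ]
    {L : StrongDual ℝ E} (hL : ‖L‖ ≤ 1) : covarianceBilinDual μ L L ≤ ∫ x, ‖x‖ ^ 2 ∂μ := by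
  have hle (x : E) : ‖L x‖ ≤ ‖x‖ := L.le_of_opNorm_le_of_le hL le_rfl |>.trans_eq (one_mul _)
  calc covarianceBilinDual μ L L = Var[L; μ] :=
        covarianceBilinDual_self_eq_variance IsGaussian.memLp_two_id L
    _ ≤ ∫ x, L x ^ 2 ∂μ := variance_le_expectation_sq (by fun_prop)
    _ ≤ ∫ x, ‖x‖ ^ 2 ∂μ :=
      integral_mono (IsGaussian.memLp_dual μ L 2 (by simp)).integrable_sq
        (IsGaussian.memLp_two_id (μ := μ)).integrable_norm_pow' fun x ↦ by
          simpa only [Real.norm_eq_abs, sq_abs] using pow_le_pow_left₀ (norm_nonneg _) (hle x) 2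

lemma norm_le_of_mem_gaussianFactors {μ : Measure E} [IsGaussian μ] {T : V →L[ℝ] E}
    (hT : T ∈ gaussianFactors V μ) : ‖T‖ ≤ √(∫ x, ‖x‖ ^ 2 ∂μ) := by
  refine T.opNorm_le_bound (Real.sqrt_nonneg _) fun z ↦ ?_
  obtain ⟨L, hL, hLz⟩ := exists_dual_vector'' ℝ (T z)
  have hcomp : ‖L.comp T‖ ≤ √(∫ x, ‖x‖ ^ 2 ∂μ) := by
    refine Real.le_sqrt_of_sq_le ?_
    rw [mem_gaussianFactors_iff.1 hT L]
    exact covarianceBilinDual_self_le_integral_norm_sq μ hL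
  calc ‖T z‖ = L.comp T z := hLz.symm
    _ ≤ ‖L.comp T‖ * ‖z‖ := (Real.le_norm_self _).trans ((L.comp T).le_opNorm z)
    _ ≤ √(∫ x, ‖x‖ ^ 2 ∂μ) * ‖z‖ := by gcongr

end GaussianFactors

section FiniteDimensional

variable {V E : Type*} [NormedAddCommGroup V] [InnerProductSpace ℝ V] [FiniteDimensional ℝ V]
  [MeasurableSpace V] [BorelSpace V]
  [NormedAddCommGroup E] [NormedSpace ℝ E] [FiniteDimensional ℝ E] [MeasurableSpace E]
  [BorelSpace E]

lemma isCompact_gaussianFactors (μ : Measure E) [IsGaussian μ] :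
    IsCompact (gaussianFactors V μ) :=
  Metric.isCompact_of_isClosed_isBounded (isClosed_gaussianFactors μ) <|
    isBounded_iff_forall_norm_le.2 ⟨_, fun _ ↦ norm_le_of_mem_gaussianFactors⟩

open Matrix in
lemma exists_eq_multivariateGaussian {ι : Type*} [Fintype ι] [DecidableEq ι]
    (μ : Measure (EuclideanSpace ℝ ι)) [IsGaussian μ] :
    ∃ S, μ = multivariateGaussian (∫ x, x ∂μ) S := by
  let b := (EuclideanSpace.basisFun ι ℝ).toBasis
  let S := LinearMap.toMatrix₂ b b (covarianceBilin μ).toBilinForm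
  have hS : S.PosSemidef :=
    (LinearMap.isPosSemidef_iff_posSemidef_toMatrix b).1
      (LinearMap.BilinForm.isPosSemidef_iff.1 isPosSemidef_covarianceBilin)
  refine ⟨S, IsGaussian.ext ?_ ?_⟩
  · simp
  · ext x y
    rw [covarianceBilin_multivariateGaussian hS]
    exact apply_eq_star_dotProduct_toMatrix₂_mulVec b x y

lemma exists_eq_affineGaussian (μ : Measure E) [IsGaussian μ] :
    ∃ (m : E) (T : EuclideanSpace ℝ (Fin (Module.finrank ℝ E)) →L[ℝ] E),
      μ = affineGaussian m T := by
  let e := (toEuclidean (E := E))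
  have : IsGaussian (μ.map e) := isGaussian_map_equiv e
  obtain ⟨S, hS⟩ := exists_eq_multivariateGaussian (μ.map e)
  have hinv : μ = (μ.map e).map e.symm := by
    rw [Measure.map_map (by fun_prop) (by fun_prop), e.symm_comp_self, Measure.map_id]
  rw [hinv, hS, multivariateGaussian, ← affineGaussian]
  exact ⟨_, _, map_affineGaussian _ _ e.symm.toContinuousLinearMap⟩

end FiniteDimensional

section GaussianPlans

variable {V E F : Type*} [NormedAddCommGroup V] [InnerProductSpace ℝ V] [FiniteDimensional ℝ V]
  [MeasurableSpace V] [BorelSpace V]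
  [NormedAddCommGroup E] [NormedSpace ℝ E] [MeasurableSpace E] [BorelSpace E]
  [NormedAddCommGroup F] [NormedSpace ℝ F] [MeasurableSpace F] [BorelSpace F]

/-- The Gaussian couplings of `μ` and `ν`: the plans available between one component of the first
mixture and one component of the second. -/
def gaussianPlans (μ : Measure E) (ν : Measure F) : Set (Measure (E × F)) :=
  {γ | IsGaussian γ ∧ γ.map Prod.fst = μ ∧ γ.map Prod.snd = ν}

lemma prod_mem_gaussianPlans [SecondCountableTopologyEither E F] (μ : Measure E) (ν : Measure F)
    [IsGaussian μ] [IsGaussian ν] :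
    μ.prod ν ∈ gaussianPlans μ ν :=
  ⟨inferInstance, by simp, by simp⟩

lemma affineGaussian_mem_gaussianPlans [SecondCountableTopologyEither E F] {μ : Measure E}
    {ν : Measure F} {P : V →L[ℝ] E} {Q : V →L[ℝ] F} (hP : P ∈ gaussianFactors V μ)
    (hQ : Q ∈ gaussianFactors V ν) :
    affineGaussian (∫ x, x ∂μ, ∫ y, y ∂ν) (P.prod Q) ∈ gaussianPlans μ ν :=
  ⟨inferInstance, (map_affineGaussian _ _ (.fst ℝ E F)).trans hP,
    (map_affineGaussian _ _ (.snd ℝ E F)).trans hQ⟩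

variable [FiniteDimensional ℝ E] [FiniteDimensional ℝ F]

lemma exists_gaussianFactors_of_mem_gaussianPlans {μ : Measure E} {ν : Measure F}
    {γ : Measure (E × F)} (hγ : γ ∈ gaussianPlans μ ν) :
    ∃ P ∈ gaussianFactors (EuclideanSpace ℝ (Fin (Module.finrank ℝ (E × F)))) μ,
      ∃ Q ∈ gaussianFactors (EuclideanSpace ℝ (Fin (Module.finrank ℝ (E × F)))) ν,
        γ = affineGaussian (∫ x, x ∂μ, ∫ y, y ∂ν) (P.prod Q) := by
  obtain ⟨hgauss, rfl, rfl⟩ := hγ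
  obtain ⟨⟨m, n⟩, T, rfl⟩ := exists_eq_affineGaussian γ
  have hfst := map_affineGaussian (m, n) T (.fst ℝ E F)
  have hsnd := map_affineGaussian (m, n) T (.snd ℝ E F)
  simp only [ContinuousLinearMap.coe_fst', ContinuousLinearMap.coe_snd'] at hfst hsnd
  rw [hfst, hsnd, integral_id_affineGaussian, integral_id_affineGaussian]
  exact ⟨_, mem_gaussianFactors_affineGaussian _ _, _, mem_gaussianFactors_affineGaussian _ _, rfl⟩

end GaussianPlans

section Existence

variable {E F : Type*}
  [NormedAddCommGroup E] [NormedSpace ℝ E] [FiniteDimensional ℝ E] [MeasurableSpace E]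
  [BorelSpace E]
  [NormedAddCommGroup F] [NormedSpace ℝ F] [FiniteDimensional ℝ F] [MeasurableSpace F]
  [BorelSpace F]

theorem exists_optimal_gaussianPlan (μ : Measure E) (ν : Measure F) [IsGaussian μ] [IsGaussian ν]
    {c : E × F → ℝ≥0∞} (hc : LowerSemicontinuous c) :
    ∃ γ ∈ gaussianPlans μ ν, ∀ γ' ∈ gaussianPlans μ ν, ∫⁻ y, c y ∂γ ≤ ∫⁻ y, c y ∂γ' := by
  obtain ⟨P₀, hP₀, Q₀, hQ₀, -⟩ :=
    exists_gaussianFactors_of_mem_gaussianPlans (prod_mem_gaussianPlans μ ν)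
  let V := EuclideanSpace ℝ (Fin (Module.finrank ℝ (E × F)))
  have hlsc : LowerSemicontinuous fun T : (V →L[ℝ] E) × (V →L[ℝ] F) ↦
      ∫⁻ y, c y ∂affineGaussian (∫ x, x ∂μ, ∫ y, y ∂ν) (T.1.prod T.2) :=
    (lowerSemicontinuous_lintegral_affineGaussian hc _).comp
      (ContinuousLinearMap.prodₗᵢ ℝ).continuous
  obtain ⟨⟨P, Q⟩, ⟨hP, hQ⟩, hmin⟩ := (hlsc.lowerSemicontinuousOn _).exists_isMinOn
    ⟨(P₀, Q₀), Set.mk_mem_prod hP₀ hQ₀⟩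
    ((isCompact_gaussianFactors μ).prod (isCompact_gaussianFactors ν))
  refine ⟨_, affineGaussian_mem_gaussianPlans hP hQ, fun γ' hγ' ↦ ?_⟩
  obtain ⟨P', hP', Q', hQ', rfl⟩ := exists_gaussianFactors_of_mem_gaussianPlans hγ'
  exact hmin (Set.mk_mem_prod hP' hQ')

end Existence

section Mixtures

variable {α E F : Type*} [MeasurableSpace E] [MeasurableSpace F]

lemma lintegral_linearCombination (ν : α → Measure E) (w : α →₀ ℝ≥0) (f : E → ℝ≥0∞) :
    ∫⁻ x, f x ∂(Finsupp.linearCombination ℝ≥0 ν w) =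
      Finsupp.linearCombination ℝ≥0 (fun i ↦ ∫⁻ x, f x ∂ν i) w := by
  simp only [Finsupp.linearCombination_apply, Finsupp.sum, lintegral_finsetSum_measure,
    lintegral_smul_measure]

lemma map_linearCombination (ν : α → Measure E) (w : α →₀ ℝ≥0) {f : E → F} (hf : Measurable f) :
    (Finsupp.linearCombination ℝ≥0 ν w).map f =
      Finsupp.linearCombination ℝ≥0 (fun i ↦ (ν i).map f) w := by
  simp only [Finsupp.linearCombination_apply, Finsupp.sum, Measure.map_finset_sum hf.aemeasurable,
    Measure.map_smul]

variable [TopologicalSpace E] [AddCommMonoid E] [Module ℝ E]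

lemma isProbabilityMeasure_of_mem_GMM {K : ℕ} {μ : Measure E} (hμ : μ ∈ GMM E K) :
    IsProbabilityMeasure μ := by
  obtain ⟨π, ν, hπ, hν, rfl⟩ := hμ
  refine ⟨?_⟩
  have hmass (k) : (π k • ν k) Set.univ = π k := by
    have := hν k
    rw [Measure.smul_apply, measure_univ, ENNReal.smul_def, smul_eq_mul, mul_one]
  rw [Measure.finsetSum_apply, Finset.sum_congr rfl fun k _ ↦ hmass k, ← ENNReal.ofNNReal_finsetSum,
    hπ, ENNReal.coe_one]

lemma mem_GMM_of_linearCombination {K : ℕ} {w : α →₀ ℝ≥0} {ν : α → Measure E}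
    (hν : ∀ i ∈ w.support, IsGaussian (ν i)) (hdeg : w.degree = 1) (hcard : w.support.card ≤ K) :
    Finsupp.linearCombination ℝ≥0 ν w ∈ GMM E K := by
  have hsupport : w.support.Nonempty := by
    rw [Finsupp.support_nonempty_iff]
    rintro rfl
    simp at hdeg
  have := hsupport.to_subtype
  obtain ⟨e⟩ : Nonempty (w.support ↪ Fin K) :=
    Function.Embedding.nonempty_of_card_le (by simpa using hcard)
  let g : Fin K → w.support := Function.invFun e
  have hge : g ∘ e = id := Function.invFun_comp e.injective
  let u := w.subtypeDomain (· ∈ w.support)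
  have hu : u.mapDomain Subtype.val = w := by
    classical
    rw [← Function.Embedding.coe_subtype, ← Finsupp.embDomain_eq_mapDomain,
      ← Finsupp.extendDomain_eq_embDomain_subtype]
    exact Finsupp.extendDomain_subtypeDomain w fun _ h ↦ h
  refine ⟨u.mapDomain e, fun k ↦ ν (g k), ?_, fun k ↦ hν _ (g k).2, ?_⟩
  · rw [← Finsupp.degree_eq_sum, Finsupp.degree_mapDomain, ← Finsupp.degree_mapDomain Subtype.val,
      hu, hdeg]
  · calc Finsupp.linearCombination ℝ≥0 ν w
        = Finsupp.linearCombination ℝ≥0 (ν ∘ Subtype.val) u := by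
          rw [← Finsupp.linearCombination_mapDomain, hu]
      _ = Finsupp.linearCombination ℝ≥0 (ν ∘ Subtype.val ∘ g) (u.mapDomain e) := by
          rw [Finsupp.linearCombination_mapDomain, Function.comp_assoc, Function.comp_assoc, hge,
            Function.comp_id]
      _ = ∑ k, u.mapDomain e k • ν (g k) := by
          rw [Finsupp.linearCombination_apply, Finsupp.sum_fintype _ _ (by simp)]
          rfl

lemma exists_linearCombination_of_mem_GMM {K : ℕ} {μ : Measure E} (hμ : μ ∈ GMM E K) :
    ∃ w : Measure E →₀ ℝ≥0, (∀ ν ∈ w.support, IsGaussian ν) ∧ w.degree = 1 ∧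
      w.support.card ≤ K ∧ Finsupp.linearCombination ℝ≥0 id w = μ := by
  classical
  obtain ⟨π, ν, hπ, hν, rfl⟩ := hμ
  let w := Finsupp.equivFunOnFinite.symm π
  have hsupport : (w.mapDomain ν).support ⊆ w.support.image ν := Finsupp.mapDomain_support
  refine ⟨w.mapDomain ν, fun ρ hρ ↦ ?_, ?_, ?_, ?_⟩
  · obtain ⟨k, -, rfl⟩ := Finset.mem_image.1 (hsupport hρ)
    exact hν k
  · rw [Finsupp.degree_mapDomain, Finsupp.degree_eq_sum]
    exact hπ
  · calc (w.mapDomain ν).support.card ≤ w.support.card :=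
          (Finset.card_le_card hsupport).trans Finset.card_image_le
      _ ≤ K := by simpa using w.support.card_le_univ
  · rw [Finsupp.linearCombination_mapDomain, Finsupp.linearCombination_apply,
      Finsupp.sum_fintype _ _ (by simp)]
    rfl

end Mixtures

section MixturePlans

variable {E F : Type*}
  [NormedAddCommGroup E] [NormedSpace ℝ E] [MeasurableSpace E]
  [NormedAddCommGroup F] [NormedSpace ℝ F] [MeasurableSpace F]

/-- The least transport cost between the Gaussian measures `p.1` and `p.2` among Gaussian plans:
the cost of the pair `p` in the discrete transport problem between the weights of two mixtures. -/
noncomputable def gaussianCost (c : E × F → ℝ≥0∞) (p : Measure E × Measure F) : ℝ≥0∞ :=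
  ⨅ γ ∈ gaussianPlans p.1 p.2, ∫⁻ y, c y ∂γ

/-- The pair of the two marginals of a measure on `E × F`. -/
noncomputable def marginals (γ : Measure (E × F)) : Measure E × Measure F :=
  (γ.map Prod.fst, γ.map Prod.snd)

lemma mem_gaussianPlans_marginals {γ : Measure (E × F)} (hγ : IsGaussian γ) :
    γ ∈ gaussianPlans (marginals γ).1 (marginals γ).2 :=
  ⟨hγ, rfl, rfl⟩

lemma linearCombination_gaussianCost_mapDomain_marginals_le (c : E × F → ℝ≥0∞)
    {u : Measure (E × F) →₀ ℝ≥0} (hu : ∀ γ ∈ u.support, IsGaussian γ) :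
    Finsupp.linearCombination ℝ≥0 (gaussianCost c) (u.mapDomain marginals) ≤
      ∫⁻ y, c y ∂(Finsupp.linearCombination ℝ≥0 id u) := by
  rw [Finsupp.linearCombination_mapDomain, lintegral_linearCombination,
    Finsupp.linearCombination_apply, Finsupp.linearCombination_apply]
  refine Finset.sum_le_sum fun γ hγ ↦ smul_le_smul_of_nonneg_left ?_ zero_le
  exact iInf₂_le γ (mem_gaussianPlans_marginals (hu γ hγ))

lemma map_linearCombination_of_mem_weightCouplings
    {w₀ : Measure E →₀ ℝ≥0} {w₁ : Measure F →₀ ℝ≥0} {W : Measure E × Measure F →₀ ℝ≥0}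
    (hW : W ∈ weightCouplings w₀ w₁) {G : Measure E × Measure F → Measure (E × F)}
    (hG : ∀ p ∈ W.support, G p ∈ gaussianPlans p.1 p.2) :
    (Finsupp.linearCombination ℝ≥0 G W).map Prod.fst = Finsupp.linearCombination ℝ≥0 id w₀ ∧
      (Finsupp.linearCombination ℝ≥0 G W).map Prod.snd = Finsupp.linearCombination ℝ≥0 id w₁ := by
  rw [map_linearCombination _ _ measurable_fst, map_linearCombination _ _ measurable_snd, ← hW.1,
    ← hW.2, Finsupp.linearCombination_mapDomain, Finsupp.linearCombination_mapDomain]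
  simp only [Finsupp.linearCombination_apply]
  exact ⟨Finsupp.sum_congr fun p hp ↦ congrArg _ (hG p hp).2.1,
    Finsupp.sum_congr fun p hp ↦ congrArg _ (hG p hp).2.2⟩

lemma mapDomain_map_eq_of_map_linearCombination_eq {X : Type*} [MeasurableSpace X]
    [BorelSpace F] [CompleteSpace F] [SecondCountableTopology F] {f : X → F} (hf : Measurable f)
    {u : Measure X →₀ ℝ≥0} {w : Measure F →₀ ℝ≥0}
    (hu : ∀ γ ∈ u.support, IsGaussian (γ.map f)) (hw : ∀ ν ∈ w.support, IsGaussian ν)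
    (heq : (Finsupp.linearCombination ℝ≥0 id u).map f = Finsupp.linearCombination ℝ≥0 id w) :
    u.mapDomain (Measure.map f) = w := by
  classical
  refine linearIndepOn_iffₛ.1 linearIndepOn_id_isGaussian _ (fun ν hν ↦ ?_) w hw ?_
  · obtain ⟨γ, hγ, rfl⟩ := Finset.mem_image.1 (Finsupp.mapDomain_support hν)
    exact hu γ hγ
  · rw [Finsupp.linearCombination_mapDomain, ← heq, map_linearCombination _ _ hf]
    rfl

variable [BorelSpace E] [BorelSpace F]

lemma mapDomain_marginals_mem_weightCouplings [CompleteSpace E] [SecondCountableTopology E]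
    [CompleteSpace F] [SecondCountableTopology F] {u : Measure (E × F) →₀ ℝ≥0}
    (hu : ∀ γ ∈ u.support, IsGaussian γ) {w₀ : Measure E →₀ ℝ≥0} {w₁ : Measure F →₀ ℝ≥0}
    (hw₀ : ∀ ν ∈ w₀.support, IsGaussian ν) (hw₁ : ∀ ν ∈ w₁.support, IsGaussian ν)
    (hfst : (Finsupp.linearCombination ℝ≥0 id u).map Prod.fst =
      Finsupp.linearCombination ℝ≥0 id w₀)
    (hsnd : (Finsupp.linearCombination ℝ≥0 id u).map Prod.snd =
      Finsupp.linearCombination ℝ≥0 id w₁) :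
    u.mapDomain marginals ∈ weightCouplings w₀ w₁ := by
  constructor
  · rw [← Finsupp.mapDomain_comp]
    refine mapDomain_map_eq_of_map_linearCombination_eq measurable_fst (fun γ hγ ↦ ?_) hw₀ hfst
    have := hu γ hγ
    exact isGaussian_map (L := ContinuousLinearMap.fst ℝ E F)
  · rw [← Finsupp.mapDomain_comp]
    refine mapDomain_map_eq_of_map_linearCombination_eq measurable_snd (fun γ hγ ↦ ?_) hw₁ hsnd
    have := hu γ hγ
    exact isGaussian_map (L := ContinuousLinearMap.snd ℝ E F)

lemma exists_gaussianPlan_lintegral_eq_gaussianCost [FiniteDimensional ℝ E] [FiniteDimensional ℝ F]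
    {c : E × F → ℝ≥0∞} (hc : LowerSemicontinuous c) {p : Measure E × Measure F}
    (h₁ : IsGaussian p.1) (h₂ : IsGaussian p.2) :
    ∃ γ ∈ gaussianPlans p.1 p.2, ∫⁻ y, c y ∂γ = gaussianCost c p := by
  obtain ⟨γ, hγ, hmin⟩ := exists_optimal_gaussianPlan p.1 p.2 hc
  exact ⟨γ, hγ, le_antisymm (le_iInf₂ hmin) (iInf₂_le γ hγ)⟩

lemma exists_gaussianMixturePlan_of_mem_weightCouplings [FiniteDimensional ℝ E]
    [FiniteDimensional ℝ F] {c : E × F → ℝ≥0∞} (hc : LowerSemicontinuous c)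
    {w₀ : Measure E →₀ ℝ≥0} {w₁ : Measure F →₀ ℝ≥0} (hw₀ : ∀ ν ∈ w₀.support, IsGaussian ν)
    (hw₁ : ∀ ν ∈ w₁.support, IsGaussian ν) (hdeg : w₀.degree = 1)
    {W : Measure E × Measure F →₀ ℝ≥0} (hW : W ∈ weightCouplings w₀ w₁) {K : ℕ}
    (hcard : W.support.card ≤ K) :
    ∃ γ ∈ GMM (E × F) K,
      γ.map Prod.fst = Finsupp.linearCombination ℝ≥0 id w₀ ∧
      γ.map Prod.snd = Finsupp.linearCombination ℝ≥0 id w₁ ∧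
      ∫⁻ y, c y ∂γ = Finsupp.linearCombination ℝ≥0 (gaussianCost c) W := by
  have hoptimal (p) (hp : p ∈ W.support) :
      ∃ γ ∈ gaussianPlans p.1 p.2, ∫⁻ y, c y ∂γ = gaussianCost c p := by
    obtain ⟨h₁, h₂⟩ := Finset.mem_product.1 (support_subset_of_mem_weightCouplings hW hp)
    exact exists_gaussianPlan_lintegral_eq_gaussianCost hc (hw₀ _ h₁) (hw₁ _ h₂)
  choose! G hG hcost using hoptimal
  have hWdeg : W.degree = 1 := by rw [← hdeg, ← hW.1, Finsupp.degree_mapDomain]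
  obtain ⟨hfst, hsnd⟩ := map_linearCombination_of_mem_weightCouplings hW hG
  refine ⟨_, mem_GMM_of_linearCombination (fun p hp ↦ (hG p hp).1) hWdeg hcard, hfst, hsnd, ?_⟩
  rw [lintegral_linearCombination, Finsupp.linearCombination_apply, Finsupp.linearCombination_apply]
  exact Finsupp.sum_congr fun p hp ↦ by rw [hcost p hp]

end MixturePlans

theorem mainTheorem8_general {E : Type*} [NormedAddCommGroup E] [NormedSpace ℝ E]
    [FiniteDimensional ℝ E] [MeasurableSpace E] [BorelSpace E] {c : E × E → ℝ≥0∞}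
    (hc : LowerSemicontinuous c) {K₀ K₁ : ℕ} {μ₀ μ₁ : Measure E} (hμ₀ : μ₀ ∈ GMM E K₀)
    (hμ₁ : μ₁ ∈ GMM E K₁) :
    ∃ γ ∈ transportPlans μ₀ μ₁ ∩ GMM (E × E) (K₀ + K₁ - 1),
      ∫⁻ y, c y ∂γ = ⨅ γ ∈ transportPlans μ₀ μ₁ ∩ GMMInf (E × E), ∫⁻ y, c y ∂γ := by
  obtain ⟨w₀, hw₀, hdeg₀, hcard₀, rfl⟩ := exists_linearCombination_of_mem_GMM hμ₀
  obtain ⟨w₁, hw₁, hdeg₁, hcard₁, rfl⟩ := exists_linearCombination_of_mem_GMM hμ₁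
  have hw₀_ne : w₀ ≠ 0 := by
    rintro rfl
    simp at hdeg₀
  obtain ⟨W, hW, hcard, hmin⟩ := exists_sparse_optimal_weightCoupling hw₀_ne
    (weightCouplings_nonempty hdeg₀ hdeg₁) (gaussianCost c)
  obtain ⟨γ, hγ, hfst, hsnd, hcost⟩ :=
    exists_gaussianMixturePlan_of_mem_weightCouplings hc hw₀ hw₁ hdeg₀ hW
      (K := K₀ + K₁ - 1) (by lia)
  have hplan : γ ∈ transportPlans _ _ := ⟨isProbabilityMeasure_of_mem_GMM hγ, hfst, hsnd⟩
  refine ⟨γ, ⟨hplan, hγ⟩, le_antisymm (le_iInf₂ ?_)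
    (iInf₂_le γ ⟨hplan, Set.mem_iUnion_of_mem _ hγ⟩)⟩
  rintro γ' ⟨⟨-, hfst', hsnd'⟩, hγ'⟩
  obtain ⟨K, hγ'⟩ := Set.mem_iUnion.1 hγ'
  obtain ⟨u, hu, -, -, rfl⟩ := exists_linearCombination_of_mem_GMM hγ'
  calc ∫⁻ y, c y ∂γ = Finsupp.linearCombination ℝ≥0 (gaussianCost c) W := hcost
    _ ≤ Finsupp.linearCombination ℝ≥0 (gaussianCost c) (u.mapDomain marginals) :=
      hmin _ (mapDomain_marginals_mem_weightCouplings hu hw₀ hw₁ hfst' hsnd')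
    _ ≤ ∫⁻ y, c y ∂(Finsupp.linearCombination ℝ≥0 id u) :=
      linearCombination_gaussianCost_mapDomain_marginals_le c hu

theorem mainTheorem8 {d : ℕ} (K₀ K₁ : ℕ) (μ₀ μ₁ : Measure (EuclideanSpace ℝ (Fin d)))
    (hμ₀ : μ₀ ∈ GMM (EuclideanSpace ℝ (Fin d)) K₀)
    (hμ₁ : μ₁ ∈ GMM (EuclideanSpace ℝ (Fin d)) K₁) :
    ∃ γ ∈ transportPlans μ₀ μ₁ ∩
        GMM (EuclideanSpace ℝ (Fin d) × EuclideanSpace ℝ (Fin d)) (K₀ + K₁ - 1),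
      quadCost γ = MW2Sq μ₀ μ₁ :=
  mainTheorem8_general (c := fun y ↦ ENNReal.ofReal (‖y.1 - y.2‖ ^ 2))
    (Continuous.lowerSemicontinuous (ENNReal.continuous_ofReal.comp (by fun_prop))) hμ₀ hμ₁
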